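/- Let $\vartheta:\mathbb{R}^{n}\to\mathbb{R}\cup\{+\infty\}$ be closed (its epigraph is closed), proper and convex, with effective domain $D=\operatorname{dom}(\vartheta)=\{x:\vartheta(x)<+\infty\}$. Write $\operatorname{ri}(D)$ for the relative interior of $D$, $\operatorname{rbd}(D)=\overline{D}\setminus\operatorname{ri}(D)$ for its relative boundary, and $\operatorname{dom}(\partial\vartheta)$ for the set of points at which $\vartheta$ has at least one subgradient. Differentiability of $\vartheta$ on $\operatorname{ri}(D)$ and the gradient $\nabla\vartheta$ are understood relative to the affine hull of $D$ (so $\nabla\vartheta(x)$ lies in the direction space of the affine hull; this is the usual gradient if $D$ has nonempty interior). Call $\vartheta$ *steep* if $D$ is nonempty and convex, $\vartheta$ is differentiable on $\operatorname{ri}(D)$, and $\|\nabla\vartheta(x_k)\|\to+\infty$ for every sequence $(x_k)$ in $\operatorname{ri}(D)$ converging to a point of $\operatorname{rbd}(D)$. Call $\vartheta$ *non-steep* if $\vartheta$ is differentiable on $\operatorname{ri}(D)$ and $(\|\nabla\vartheta(x_k)\|)$ is bounded for every sequence $(x_k)$ in $\operatorname{ri}(D)$ converging to a point of $\operatorname{rbd}(D)$.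 Then the following hold. (i) If $\vartheta$ is steep, then $\operatorname{dom}(\partial\vartheta)=\operatorname{ri}(D)$, and $\operatorname{rbd}(D)\not\subseteq\operatorname{dom}(\partial\vartheta)$ whenever $\operatorname{rbd}(D)\neq\varnothing$. (ii) If $\vartheta$ is non-steep, then $\operatorname{rbd}(D)\subseteq\operatorname{dom}(\partial\vartheta)$ and $\operatorname{dom}(\partial\vartheta)=D$. -/

import Mathlib

namespace ConvexReg

open Filter Topology

/-- Effective domain of an extended-real-valued function. -/
def dom {n : ℕ} (f : EuclideanSpace ℝ (Fin n) → EReal) : Set (EuclideanSpace ℝ (Fin n)) :=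
  {x | f x < ⊤}

/-- Epigraph of an extended-real-valued function. -/
def epigraph {n : ℕ} (f : EuclideanSpace ℝ (Fin n) → EReal) :
    Set (EuclideanSpace ℝ (Fin n) × ℝ) :=
  {q | f q.1 ≤ (q.2 : EReal)}

/-- Proper: the value `-∞` is never attained and some value is less than `+∞`. -/
def IsProper {n : ℕ} (f : EuclideanSpace ℝ (Fin n) → EReal) : Prop :=
  (∀ x, f x ≠ ⊥) ∧ ∃ x, f x < ⊤

/-- Closed: the epigraph is closed. -/
def IsClosedFun {n : ℕ} (f : EuclideanSpace ℝ (Fin n) → EReal) : Prop :=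
  IsClosed (epigraph f)

/-- Convex: the epigraph is convex. -/
def IsConvexFun {n : ℕ} (f : EuclideanSpace ℝ (Fin n) → EReal) : Prop :=
  Convex ℝ (epigraph f)

/-- Relative interior. -/
def ri {n : ℕ} (C : Set (EuclideanSpace ℝ (Fin n))) : Set (EuclideanSpace ℝ (Fin n)) :=
  intrinsicInterior ℝ C

/-- Relative boundary: closure minus relative interior. -/
def rbd {n : ℕ} (C : Set (EuclideanSpace ℝ (Fin n))) : Set (EuclideanSpace ℝ (Fin n)) :=
  closure C \ ri C

/-- Subdifferential: all `v` with `f y ≥ f x + ⟨v, y - x⟩` for every `y`.  For proper `f` it is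
empty at points where `f x = +∞`. -/
def subdiff {n : ℕ} (f : EuclideanSpace ℝ (Fin n) → EReal) (x : EuclideanSpace ℝ (Fin n)) :
    Set (EuclideanSpace ℝ (Fin n)) :=
  {v | ∀ y, f x + ((inner ℝ v (y - x) : ℝ) : EReal) ≤ f y}

/-- Domain of the subdifferential. -/
def domSubdiff {n : ℕ} (f : EuclideanSpace ℝ (Fin n) → EReal) :
    Set (EuclideanSpace ℝ (Fin n)) :=
  {x | (subdiff f x).Nonempty}

/-- `g` is the gradient of `f` at `x` relative to the affine hull of `dom f`, meant for
`x ∈ ri (dom f)`: `g` lies in the direction space of the affine hull and is the gradient of `f`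
within `dom f`, which near such an `x` is all of the affine hull.  If `dom f` has nonempty
interior, this is the usual gradient. -/
def HasRelGradientAt {n : ℕ} (f : EuclideanSpace ℝ (Fin n) → EReal)
    (g x : EuclideanSpace ℝ (Fin n)) : Prop :=
  g ∈ (affineSpan ℝ (dom f)).direction ∧
    HasGradientWithinAt (fun y => (f y).toReal) g (dom f) x

/-- Differentiable on the relative interior of the domain. -/
def DifferentiableOnRi {n : ℕ} (f : EuclideanSpace ℝ (Fin n) → EReal) : Prop :=
  ∀ x ∈ ri (dom f), ∃ g, HasRelGradientAt f g x

/-- Steep (relatively essentially smooth): the gradient norms tend to `+∞` along every sequence in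
the relative interior of the domain that converges to a relative boundary point.  The sequence of
gradients is written `g`. -/
def IsSteep {n : ℕ} (f : EuclideanSpace ℝ (Fin n) → EReal) : Prop :=
  (dom f).Nonempty ∧ Convex ℝ (dom f) ∧ DifferentiableOnRi f ∧
    ∀ x g : ℕ → EuclideanSpace ℝ (Fin n),
      (∀ k, x k ∈ ri (dom f)) → (∀ k, HasRelGradientAt f (g k) (x k)) →
      ∀ a ∈ rbd (dom f), Tendsto x atTop (𝓝 a) → Tendsto (fun k => ‖g k‖) atTop atTop

/-- Non-steep: the gradient norms stay bounded along every sequence in the relative interior of the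
domain that converges to a relative boundary point. -/
def IsNonSteep {n : ℕ} (f : EuclideanSpace ℝ (Fin n) → EReal) : Prop :=
  DifferentiableOnRi f ∧
    ∀ x g : ℕ → EuclideanSpace ℝ (Fin n),
      (∀ k, x k ∈ ri (dom f)) → (∀ k, HasRelGradientAt f (g k) (x k)) →
      ∀ a ∈ rbd (dom f), Tendsto x atTop (𝓝 a) → ∃ M : ℝ, ∀ k, ‖g k‖ ≤ M

end ConvexReg

section RelativeInterior

variable {V : Type*} [NormedAddCommGroup V] [NormedSpace ℝ V] {s : Set V} {x y : V}

/-! Write F for the real-valued restriction of f to D. By convexity, a relative gradient at a point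
of ri D is a global subgradient, so ri D always lies in the domain of the subdifferential. Both
halves then follow the gradients along a segment from a point x to some z in ri D.

Steep case: a subgradient at x bounds F from below on the segment, while chords from x to points
near z bound it from above. The gradients on the segment are therefore bounded
(`ConvexOn.exists_norm_gradient_le_of_subgradient`), which steepness forbids if x is a relative
boundary point.

Non-steep case: the gradients are bounded by hypothesis, so a subsequence converges. Its limit is a
subgradient at the endpoint because the subdifferential has closed graph
(`IsClosedFun.mem_subdiff_of_tendsto`). -/

theorem mem_intrinsicInterior_iff_ball :
    x ∈ intrinsicInterior ℝ s ↔ x ∈ affineSpan ℝ s ∧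
      ∃ ε > 0, ∀ q ∈ affineSpan ℝ s, ‖q - x‖ < ε → q ∈ s := by
  constructor
  · rintro ⟨p, hp, rfl⟩
    obtain ⟨ε, hε, hb⟩ := Metric.mem_nhds_iff.1 (mem_interior_iff_mem_nhds.1 hp)
    refine ⟨p.2, ε, hε, fun q hq hqx => ?_⟩
    have : (⟨q, hq⟩ : affineSpan ℝ s) ∈ Metric.ball p ε := by
      rw [Metric.mem_ball, Subtype.dist_eq, dist_eq_norm]
      exact hqx
    exact hb this
  · rintro ⟨hx, ε, hε, hb⟩
    refine ⟨⟨x, hx⟩, mem_interior_iff_mem_nhds.2 (Metric.mem_nhds_iff.2 ⟨ε, hε, ?_⟩), rfl⟩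
    rintro ⟨q, hq⟩ hqx
    rw [Metric.mem_ball, Subtype.dist_eq, dist_eq_norm] at hqx
    exact hb q hq hqx

theorem Convex.combo_closure_intrinsicInterior_mem [FiniteDimensional ℝ V] (hs : Convex ℝ s)
    (hx : x ∈ closure s) (hy : y ∈ intrinsicInterior ℝ s) {t : ℝ} (ht : 0 < t) (ht1 : t ≤ 1) :
    x + t • (y - x) ∈ intrinsicInterior ℝ s := by
  obtain ⟨hya, ε, hε, hb⟩ := mem_intrinsicInterior_iff_ball.1 hy
  have hxa : x ∈ affineSpan ℝ s :=
    closure_minimal (subset_affineSpan ℝ s)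
      (AffineSubspace.closed_of_finiteDimensional (affineSpan ℝ s)) hx
  refine mem_intrinsicInterior_iff_ball.2 ⟨?_, t * (ε / 2), by positivity, fun q hq hqp => ?_⟩
  · have := AffineMap.lineMap_mem (Q := affineSpan ℝ s) t hxa hya
    rwa [AffineMap.lineMap_apply_module', add_comm] at this
  -- Replace x by a nearby x' in s and extend the segment from x' through q by the factor 1/t. The
  -- endpoint misses y by at most 1/t times two errors, each below tε/2, so it lies in s.
  obtain ⟨x', hx's, hx'⟩ := Metric.mem_closure_iff.1 hx (t * (ε / 2)) (by positivity)
  rw [dist_eq_norm] at hx'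
  have hy' : x' + t⁻¹ • (q - x') ∈ s := by
    apply hb
    · have := AffineMap.lineMap_mem (Q := affineSpan ℝ s) t⁻¹ (subset_affineSpan ℝ s hx's) hq
      rwa [AffineMap.lineMap_apply_module', add_comm] at this
    · have e : x' + t⁻¹ • (q - x') - y
          = t⁻¹ • ((q - (x + t • (y - x))) + (1 - t) • (x - x')) := by
        have : y = t⁻¹ • t • y := by rw [inv_smul_smul₀ ht.ne']
        have h2 : x' = t⁻¹ • t • x' := by rw [inv_smul_smul₀ ht.ne']
        nth_rewrite 1 [this, h2]
        rw [← smul_add, ← smul_sub]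
        congr 1
        module
      rw [e, norm_smul, Real.norm_of_nonneg (inv_nonneg.2 ht.le), inv_mul_lt_iff₀ ht]
      calc ‖(q - (x + t • (y - x))) + (1 - t) • (x - x')‖
          ≤ ‖q - (x + t • (y - x))‖ + (1 - t) * ‖x - x'‖ := by
            refine (norm_add_le _ _).trans ?_
            rw [norm_smul, Real.norm_of_nonneg (by linarith)]
        _ ≤ ‖q - (x + t • (y - x))‖ + 1 * ‖x - x'‖ := by gcongr; linarith
        _ < t * ε := by linarith
  have := hs hx's hy' (sub_nonneg.2 ht1) ht.le (by ring)
  convert this using 1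
  rw [smul_add, smul_inv_smul₀ ht.ne']
  module

theorem intrinsicInterior.exists_add_smul_mem (hy : y ∈ intrinsicInterior ℝ s) {w : V}
    (hw : w ∈ (affineSpan ℝ s).direction) :
    ∃ ε : ℝ, 0 < ε ∧ y + ε • w ∈ s := by
  obtain ⟨hya, ε, hε, hb⟩ := mem_intrinsicInterior_iff_ball.1 hy
  have hmem (c : ℝ) : y + c • w ∈ affineSpan ℝ s := by
    have := AffineSubspace.vadd_mem_of_mem_direction
      ((affineSpan ℝ s).direction.smul_mem c hw) hya
    rwa [vadd_eq_add, add_comm] at this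
  -- The added 1 covers w = 0.
  have hpos : 0 < ‖w‖ + 1 := by positivity
  have hlt : ε / (‖w‖ + 1) * ‖w‖ < ε := by
    rw [div_mul_eq_mul_div, div_lt_iff₀ hpos]
    nlinarith
  have hnn : 0 < ε / (‖w‖ + 1) := by positivity
  refine ⟨ε / (‖w‖ + 1), hnn, hb _ (hmem _) ?_⟩
  rwa [add_sub_cancel_left, norm_smul, Real.norm_of_nonneg hnn.le]

end RelativeInterior

section Gradient

open Topology

variable {E : Type*} [NormedAddCommGroup E] [InnerProductSpace ℝ E]

/-- Convexity bounds each difference quotient from x towards y by F y - F x; let the step tend to 0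
from above. -/
theorem ConvexOn.add_inner_le_of_hasGradientWithinAt [CompleteSpace E] {s : Set E} {F : E → ℝ}
    {g x y : E} (hF : ConvexOn ℝ s F) (hg : HasGradientWithinAt F g s x) (hx : x ∈ s)
    (hy : y ∈ s) : F x + inner ℝ g (y - x) ≤ F y := by
  have hpos : ∀ᶠ t : ℝ in 𝓝[>] 0, 0 < t ∧ t ≤ 1 :=
    Filter.mem_of_superset (Ioc_mem_nhdsGT one_pos) fun t ht => ht
  have hseg (t : ℝ) : x + t • (y - x) = (1 - t) • x + t • y := by module
  have hlim := (hasGradientWithinAt_iff_hasFDerivWithinAt.1 hg).lim (l := 𝓝[>] (0 : ℝ))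
    (c := fun t => t⁻¹) (d := fun t => t • (y - x)) (v := y - x) ?_ ?_ ?_
  · rw [InnerProductSpace.toDual_apply_apply] at hlim
    have := le_of_tendsto hlim (b := F y - F x) (hpos.mono fun t ht => ?_)
    · linarith
    rw [smul_eq_mul, inv_mul_le_iff₀ ht.1, hseg t]
    have := hF.2 hx hy (sub_nonneg.2 ht.2) ht.1.le (by ring)
    simp only [smul_eq_mul] at this
    linarith
  · have : Filter.Tendsto (fun t : ℝ => t • (y - x)) (𝓝 0) (𝓝 ((0 : ℝ) • (y - x))) :=
      (continuous_id.smul continuous_const).tendsto 0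
    rw [zero_smul] at this
    exact this.mono_left nhdsWithin_le_nhds
  · filter_upwards [hpos] with t ht
    rw [hseg t]
    exact hF.1 hx hy (sub_nonneg.2 ht.2) ht.1.le (by ring)
  · refine tendsto_const_nhds.congr' ?_
    filter_upwards [hpos] with t ht
    rw [inv_smul_smul₀ ht.1.ne']

/-- A family of vectors of a complete subspace that is weakly bounded on the subspace is bounded. -/
theorem Submodule.exists_norm_le_of_forall_inner_le {ι : Type*} (W : Submodule ℝ E)
    [CompleteSpace W] {g : ι → E} (hg : ∀ i, g i ∈ W)
    (h : ∀ w ∈ W, ∃ C : ℝ, ∀ i, inner ℝ (g i) w ≤ C) : ∃ M : ℝ, ∀ i, ‖g i‖ ≤ M := by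
  -- Uniform boundedness on W itself; testing against -w turns the one-sided bounds into two-sided
  -- ones.
  obtain ⟨M, hM⟩ := banach_steinhaus (g := fun i => innerSL ℝ (⟨g i, hg i⟩ : W)) fun w => by
    obtain ⟨C₁, h₁⟩ := h w w.2
    obtain ⟨C₂, h₂⟩ := h (-w) (W.neg_mem w.2)
    refine ⟨max C₁ C₂, fun i => ?_⟩
    have := h₂ i
    rw [inner_neg_right] at this
    rw [innerSL_apply_apply, Submodule.coe_inner, Real.norm_eq_abs]
    exact abs_le.2 ⟨by linarith [le_max_right C₁ C₂], (h₁ i).trans (le_max_left _ _)⟩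
  refine ⟨M, fun i => ?_⟩
  simpa [innerSL_apply_norm] using hM i

/-- At a point having a subgradient, gradients stay bounded along segments into the relative
interior. -/
theorem ConvexOn.exists_norm_gradient_le_of_subgradient [FiniteDimensional ℝ E] {s : Set E}
    {F : E → ℝ} {v x z : E} (hF : ConvexOn ℝ s F) (hx : x ∈ s)
    (hv : ∀ y ∈ s, F x + inner ℝ v (y - x) ≤ F y) (hz : z ∈ intrinsicInterior ℝ s)
    {t : ℕ → ℝ} (ht : ∀ k, 0 < t k) (ht1 : ∀ k, t k ≤ 1) {g : ℕ → E}
    (hgd : ∀ k, g k ∈ (affineSpan ℝ s).direction)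
    (hg : ∀ k, HasGradientWithinAt F (g k) s (x + t k • (z - x))) :
    ∃ M : ℝ, ∀ k, ‖g k‖ ≤ M := by
  refine Submodule.exists_norm_le_of_forall_inner_le _ hgd fun w hw => ?_
  obtain ⟨ε, hε, hmem⟩ := intrinsicInterior.exists_add_smul_mem hz hw
  refine ⟨ε⁻¹ * (F (z + ε • w) - F x - inner ℝ v (z - x)), fun k => ?_⟩
  rw [le_inv_mul_iff₀ hε]
  have hxk : x + t k • (z - x) ∈ s :=
    intrinsicInterior_subset
      (hF.1.combo_closure_intrinsicInterior_mem (subset_closure hx) hz (ht k) (ht1 k))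
  -- The shift is scaled by t so that the shifted point lies on the chord from x to z + εw. Every
  -- term of the final estimate then carries a factor t, which cancels and leaves a bound
  -- independent of k.
  have hseg : x + t k • (z - x) + (t k * ε) • w = (1 - t k) • x + t k • (z + ε • w) := by module
  have hyk := hF.1 hx hmem (sub_nonneg.2 (ht1 k)) (ht k).le (by ring)
  have h₁ := hF.2 hx hmem (sub_nonneg.2 (ht1 k)) (ht k).le (by ring)
  rw [← hseg] at hyk h₁
  have h₂ := hF.add_inner_le_of_hasGradientWithinAt (hg k) hxk hyk
  have h₃ := hv _ hxk
  rw [add_sub_cancel_left, inner_smul_right] at h₂ h₃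
  simp only [smul_eq_mul] at h₁
  refine le_of_mul_le_mul_left ?_ (ht k)
  linarith

end Gradient

namespace ConvexReg

open Filter Topology

variable {n : ℕ} {f : EuclideanSpace ℝ (Fin n) → EReal} {x v g : EuclideanSpace ℝ (Fin n)}

theorem IsProper.coe_toReal (hf : IsProper f) (hx : x ∈ dom f) : ((f x).toReal : EReal) = f x :=
  EReal.coe_toReal (ne_of_lt hx) (hf.1 x)

theorem IsConvexFun.convexOn_toReal (hc : IsConvexFun f) (hf : IsProper f) :
    ConvexOn ℝ (dom f) fun y => (f y).toReal := by
  have key {x y : EuclideanSpace ℝ (Fin n)} (hx : x ∈ dom f) (hy : y ∈ dom f) {a b : ℝ}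
      (ha : 0 ≤ a) (hb : 0 ≤ b) (hab : a + b = 1) :
      f (a • x + b • y) ≤ ((a * (f x).toReal + b * (f y).toReal : ℝ) : EReal) := by
    have hx' : (x, (f x).toReal) ∈ epigraph f := (hf.coe_toReal hx).ge
    have hy' : (y, (f y).toReal) ∈ epigraph f := (hf.coe_toReal hy).ge
    exact hc hx' hy' ha hb hab
  have hconv : Convex ℝ (dom f) := fun x hx y hy a b ha hb hab =>
    (key hx hy ha hb hab).trans_lt (EReal.coe_lt_top _)
  refine ⟨hconv, fun x hx y hy a b ha hb hab => ?_⟩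
  have h := key hx hy ha hb hab
  rw [← hf.coe_toReal (hconv hx hy ha hb hab), EReal.coe_le_coe_iff] at h
  exact h

theorem IsProper.mem_dom_of_mem_subdiff (hf : IsProper f) (hv : v ∈ subdiff f x) : x ∈ dom f := by
  obtain ⟨y, hy⟩ := hf.2
  by_contra hx
  have hx' : f x = ⊤ := not_lt_top_iff.1 hx
  have := hv y
  rw [hx', EReal.top_add_coe] at this
  exact hy.not_ge this

theorem IsProper.domSubdiff_subset_dom (hf : IsProper f) : domSubdiff f ⊆ dom f :=
  fun _ ⟨_, hv⟩ => hf.mem_dom_of_mem_subdiff hv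

theorem IsProper.mem_subdiff_iff (hf : IsProper f) (hx : x ∈ dom f) :
    v ∈ subdiff f x ↔ ∀ y ∈ dom f, (f x).toReal + inner ℝ v (y - x) ≤ (f y).toReal := by
  have h {y} (hy : y ∈ dom f) : f x + ((inner ℝ v (y - x) : ℝ) : EReal) ≤ f y ↔
      (f x).toReal + inner ℝ v (y - x) ≤ (f y).toReal := by
    rw [← EReal.coe_le_coe_iff, EReal.coe_add, hf.coe_toReal hx, hf.coe_toReal hy]
  refine ⟨fun hv y hy => (h hy).1 (hv y), fun hv y => ?_⟩
  by_cases hy : y ∈ dom f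
  · exact (h hy).2 (hv y hy)
  · rw [show f y = ⊤ from not_lt_top_iff.1 hy]
    exact le_top

theorem HasRelGradientAt.mem_subdiff (hg : HasRelGradientAt f g x) (hf : IsProper f)
    (hc : IsConvexFun f) (hx : x ∈ dom f) : g ∈ subdiff f x :=
  (hf.mem_subdiff_iff hx).2 fun _ hy =>
    (hc.convexOn_toReal hf).add_inner_le_of_hasGradientWithinAt hg.2 hx hy

theorem DifferentiableOnRi.ri_subset_domSubdiff (hd : DifferentiableOnRi f) (hf : IsProper f)
    (hc : IsConvexFun f) : ri (dom f) ⊆ domSubdiff f := fun x hx =>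
  let ⟨g, hg⟩ := hd x hx
  ⟨g, hg.mem_subdiff hf hc (intrinsicInterior_subset hx)⟩

theorem disjoint_rbd_ri (C : Set (EuclideanSpace ℝ (Fin n))) : Disjoint (rbd C) (ri C) :=
  Set.disjoint_sdiff_left

theorem IsSteep.domSubdiff_subset_ri (hs : IsSteep f) (hf : IsProper f) (hc : IsConvexFun f) :
    domSubdiff f ⊆ ri (dom f) := by
  rintro x ⟨v, hv⟩
  by_contra hxri
  obtain ⟨hne, -, hd, hlim⟩ := hs
  have hF := hc.convexOn_toReal hf
  have hx := hf.mem_dom_of_mem_subdiff hv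
  obtain ⟨z, hz⟩ := hne.intrinsicInterior hF.1
  -- The shift by 1 keeps every parameter in (0, 1], so all points stay in ri D.
  let t : ℕ → ℝ := fun k => 1 / ((k : ℝ) + 1)
  have ht k : 0 < t k := Nat.one_div_pos_of_nat
  have ht1 k : t k ≤ 1 := by
    simpa [t] using Nat.one_div_le_one_div (α := ℝ) (Nat.zero_le k)
  have hmem k : x + t k • (z - x) ∈ ri (dom f) :=
    hF.1.combo_closure_intrinsicInterior_mem (subset_closure hx) hz (ht k) (ht1 k)
  choose g hg using fun k => hd _ (hmem k)
  have htend : Tendsto (fun k => x + t k • (z - x)) atTop (𝓝 x) := by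
    have h := (tendsto_one_div_add_atTop_nhds_zero_nat (𝕜 := ℝ)).smul_const (z - x)
    rw [zero_smul] at h
    simpa only [add_zero] using h.const_add x
  obtain ⟨M, hM⟩ := hF.exists_norm_gradient_le_of_subgradient hx ((hf.mem_subdiff_iff hx).1 hv)
    hz ht ht1 (fun k => (hg k).1) fun k => (hg k).2
  obtain ⟨k, hk⟩ :=
    ((hlim _ g hmem hg x ⟨subset_closure hx, hxri⟩ htend).eventually_gt_atTop M).exists
  exact hk.not_ge (hM k)

/-- The subdifferential of a closed proper function has closed graph; finiteness at the limit point
is part of the conclusion. -/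
theorem IsClosedFun.mem_subdiff_of_tendsto (hcl : IsClosedFun f) (hf : IsProper f)
    {xs gs : ℕ → EuclideanSpace ℝ (Fin n)} (h : ∀ k, gs k ∈ subdiff f (xs k))
    (hx : Tendsto xs atTop (𝓝 x)) (hg : Tendsto gs atTop (𝓝 g)) : g ∈ subdiff f x := by
  -- Stated in `EReal` because f x is not yet known to be finite; a single y in the domain then
  -- gives finiteness.
  have key : ∀ y ∈ dom f, f x ≤ (((f y).toReal - inner ℝ g (y - x) : ℝ) : EReal) := by
    intro y hy
    have hmem k : (xs k, (f y).toReal - inner ℝ (gs k) (y - xs k)) ∈ epigraph f := by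
      have hk := hf.mem_dom_of_mem_subdiff (h k)
      have := (hf.mem_subdiff_iff hk).1 (h k) y hy
      change f (xs k) ≤ _
      rw [← hf.coe_toReal hk, EReal.coe_le_coe_iff]
      linarith
    exact hcl.mem_of_tendsto
      (hx.prodMk_nhds (tendsto_const_nhds.sub (hg.inner (tendsto_const_nhds.sub hx))))
      (Eventually.of_forall hmem)
  have hxd : x ∈ dom f := by
    obtain ⟨y, hy⟩ := hf.2
    exact (key y hy).trans_lt (EReal.coe_lt_top _)
  refine (hf.mem_subdiff_iff hxd).2 fun y hy => ?_
  have := key y hy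
  rw [← hf.coe_toReal hxd, EReal.coe_le_coe_iff] at this
  linarith

theorem IsNonSteep.rbd_subset_domSubdiff (hs : IsNonSteep f) (hcl : IsClosedFun f)
    (hf : IsProper f) (hc : IsConvexFun f) : rbd (dom f) ⊆ domSubdiff f := by
  intro a ha
  have hF := hc.convexOn_toReal hf
  obtain ⟨z, hz⟩ := Set.Nonempty.intrinsicInterior hF.1 hf.2
  let xs : ℕ → EuclideanSpace ℝ (Fin n) := fun k => a + (1 / ((k : ℝ) + 1)) • (z - a)
  have hmem k : xs k ∈ ri (dom f) :=
    hF.1.combo_closure_intrinsicInterior_mem ha.1 hz Nat.one_div_pos_of_nat (by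
      simpa using Nat.one_div_le_one_div (α := ℝ) (Nat.zero_le k))
  choose g hg using fun k => hs.1 _ (hmem k)
  have htend : Tendsto xs atTop (𝓝 a) := by
    have h := (tendsto_one_div_add_atTop_nhds_zero_nat (𝕜 := ℝ)).smul_const (z - a)
    rw [zero_smul] at h
    simpa only [add_zero] using h.const_add a
  obtain ⟨M, hM⟩ := hs.2 xs g hmem hg a ha htend
  obtain ⟨g₀, -, φ, hφ, hlim⟩ := tendsto_subseq_of_bounded
    (Metric.isBounded_closedBall (x := (0 : EuclideanSpace ℝ (Fin n))) (r := M))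
    (fun k => mem_closedBall_zero_iff.2 (hM k))
  exact ⟨g₀, hcl.mem_subdiff_of_tendsto hf
    (fun k => (hg (φ k)).mem_subdiff hf hc (intrinsicInterior_subset (hmem (φ k))))
    (htend.comp hφ.tendsto_atTop) hlim⟩

end ConvexReg

theorem mainTheorem7 {n : ℕ} (f : EuclideanSpace ℝ (Fin n) → EReal)
    (hclosed : ConvexReg.IsClosedFun f) (hproper : ConvexReg.IsProper f)
    (hconvex : ConvexReg.IsConvexFun f) :
    (ConvexReg.IsSteep f →
      ((ConvexReg.rbd (ConvexReg.dom f)).Nonempty →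
        ¬ ConvexReg.rbd (ConvexReg.dom f) ⊆ ConvexReg.domSubdiff f) ∧
      ConvexReg.domSubdiff f = ConvexReg.ri (ConvexReg.dom f)) ∧
    (ConvexReg.IsNonSteep f →
      ConvexReg.rbd (ConvexReg.dom f) ⊆ ConvexReg.domSubdiff f ∧
      ConvexReg.domSubdiff f = ConvexReg.dom f) := by
  refine ⟨fun hs => ?_, fun hs => ?_⟩
  · have heq : ConvexReg.domSubdiff f = ConvexReg.ri (ConvexReg.dom f) :=
      (hs.domSubdiff_subset_ri hproper hconvex).antisymm
        (hs.2.2.1.ri_subset_domSubdiff hproper hconvex)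
    refine ⟨fun ⟨a, ha⟩ hsub => ?_, heq⟩
    exact (ConvexReg.disjoint_rbd_ri _).le_bot ⟨ha, heq ▸ hsub ha⟩
  · have hrbd := hs.rbd_subset_domSubdiff hclosed hproper hconvex
    refine ⟨hrbd, hproper.domSubdiff_subset_dom.antisymm fun x hx => ?_⟩
    by_cases hxri : x ∈ ConvexReg.ri (ConvexReg.dom f)
    · exact hs.1.ri_subset_domSubdiff hproper hconvex hxri
    · exact hrbd ⟨subset_closure hx, hxri⟩
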